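/- **Contention resolution.** For $k\ge 0$ let $\mathcal P_k=\{\bm z\in[0,1]^k:\sum_{i}z_i\le 1\}$, and for $\bm z\in\mathcal P_k$ let $R(\bm z)\subseteq[k]$ be the random set containing each $i$ independently with probability $z_i$. An online contention resolution scheme $\psi$ for $1$-uniform matroids is, for every $k$ and every $\bm z\in\mathcal P_k$, a randomized algorithm to which the bits $\bm 1[i\in R(\bm z)]$, $i\in[k]$, are revealed one by one (together with $i$) in an order $\pi$ that it does not know in advance; when the bit of $i$ is revealed and $i\in R(\bm z)$, it decides irrevocably whether to return $i$, and it returns at most one element $\psi(\bm z,R(\bm z))$. It is an $\alpha$-selectable OCRS if for all $k$, all $\bm z\in\mathcal P_k$, every fixed order $\pi$ and every $i\in[k]$ with $z_i>0$, $\mathbb P[\psi(\bm z,R(\bm z))=i\mid i\in R(\bm z)]\ge\alpha$. It is an $\alpha$-selectable RCRS if the same holds when $\pi$ is a uniformly random permutation, independent of everything else (and the probability is also over $\pi$). **Stochastic graphs.** A stochastic graph $G$ on $U\times V$ ($U,V$ finite) has edge weights $w_{u,v}\in\mathbb R$, edge probabilities $p_{u,v}\in[0,1]$ and, for each $v\in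 V$, a probing constraint $\mathcal C_v$: a set of strings of distinct edges at $v$ that contains the empty string and is closed under substrings and permutations (for instance, all strings of length at most a patience $\ell_v$). Each edge $e$ is active independently with probability $p_e$. A probing algorithm adaptively probes edges, each probe revealing whether the edge is active, so that for every $v$ the string of probed edges at $v$ lies in $\mathcal C_v$; when a probed edge is active, it must decide irrevocably, before any further probe, whether to include it in its matching $\mathcal M$. $\mathrm{OPT}(G)$ is the supremum of $\mathbb E[\sum_{e\in\mathcal M}w_e]$ over all (randomized) offline probing algorithms, which know $G$ but not the edge states and may probe the edges of $G$ in any order. **Known i.d. instances.** A known i.d. input consists of a stochastic graph $H_{\mathrm{typ}}$ on $U\times B$ (the type graph, with finite set of types $B$) and distributions $\mathcal D_1,\dots,\mathcal D_n$ on $B$. Independently for each $i$, the online vertex $v_i$ has a type drawn from $\mathcal D_i$; this gives a stochastic graph $G$ on $U\times\{v_1,\dots,v_n\}$, with weights, probabilities and probing constraints inherited from the types. The benchmark is $\mathrm{OPT}(H_{\mathrm{typ}},(\mathcal D_i)_{i=1}^n)=\mathbb E[\mathrm{OPT}(G)]$. An online probing algorithm is given $H_{\mathrm{typ}}$ and $(\mathcal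 D_i)_{i=1}^n$; the vertices arrive one by one as $v_{\pi(1)},\dots,v_{\pi(n)}$ for a permutation $\pi$ of $[n]$ that it does not know in advance; upon the arrival of $v_i$ it learns $i$ and the type of $v_i$, and, before the next arrival, it may probe edges at $v_i$ as above. Let $\mathcal M$ be the matching it returns. The algorithm is $\alpha$-competitive for adversarial arrivals if for every known i.d. input and every permutation $\pi$ (chosen depending only on the input), $\mathbb E[w(\mathcal M)]\ge\alpha\cdot\mathrm{OPT}(H_{\mathrm{typ}},(\mathcal D_i)_{i=1}^n)$; it is $\alpha$-competitive for random order arrivals if this holds for every known i.d. input when $\pi$ is uniformly random and independent of everything else. **Theorem.** Let $\alpha\in[0,1]$. Given an $\alpha$-selectable OCRS for $1$-uniform matroids, there exists an $\alpha$-competitive online probing algorithm for known i.d. instances and adversarial arrivals. Given an $\alpha$-selectable RCRS for $1$-uniform matroids, there exists an $\alpha$-competitive online probing algorithm for known i.d. instances and random order arrivals. -/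

import Mathlib

open scoped BigOperators

universe u v

noncomputable section

/-! ### Elementary finite probability -/

/-- The probability that independent Bernoulli bits with success probabilities `z` take exactly
the values `Z`. -/
def bernProb {ι : Type*} [Fintype ι] (z : ι → ℝ) (Z : ι → Bool) : ℝ :=
  ∏ i, if Z i then z i else 1 - z i

/-- The expectation of a real function under a discrete distribution. It is only used with
functions that are bounded on the support of the distribution. -/
def expect {α : Type*} (μ : PMF α) (f : α → ℝ) : ℝ :=
  ∑' a, (μ a).toReal * f a

/-! ### Online contention resolution for the `1`-uniform matroid on `[k]` -/

/-- A deterministic online selection rule on the ground set `Fin k` with `t` arrivals to come.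
On an arrival, the rule learns the arriving element `i` and the bit `Z i`; it answers with its
irrevocable decision whether to return `i` (the decision has no effect if `Z i` is `false`),
and with the rule to follow for the remaining arrivals in case nothing has been returned.
The rule therefore depends on everything seen so far and on nothing else. -/
def SelectionRule (k : ℕ) : ℕ → Type
  | 0 => Unit
  | t + 1 => Fin k → Bool → Bool × SelectionRule k t

/-- The element (if any) that the rule returns when the elements arrive in the order
`arr 0, arr 1, …` and the active elements are those with `Z i = true`. -/
def SelectionRule.run {k : ℕ} (Z : Fin k → Bool) :
    (t : ℕ) → SelectionRule k t → (Fin t → Fin k) → Option (Fin k)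
  | 0, _, _ => none
  | t + 1, R, arr =>
    if Z (arr 0) && (R (arr 0) (Z (arr 0))).1 then some (arr 0)
    else SelectionRule.run Z t (R (arr 0) (Z (arr 0))).2 (fun s => arr s.succ)

/-- The convex relaxation `{z ∈ [0,1]^k : ∑ z_i ≤ 1}` of the `1`-uniform matroid on `[k]`. -/
def uniformPolytope (k : ℕ) : Set (Fin k → ℝ) :=
  {z | (∀ i, 0 ≤ z i ∧ z i ≤ 1) ∧ ∑ i, z i ≤ 1}

/-- A randomized online contention resolution scheme for `1`-uniform matroids: for every size `k`
of the ground set and every vector `z`, a distribution over deterministic online rules. -/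
def OnlineCRS : Type :=
  (k : ℕ) → (Fin k → ℝ) → PMF (SelectionRule k k)

/-- The probability that `i` belongs to the random set `R(z)`. -/
def memProb {k : ℕ} (z : Fin k → ℝ) (i : Fin k) : ℝ :=
  ∑ Z : Fin k → Bool, bernProb z Z * (if Z i then 1 else 0)

/-- The probability that `i` belongs to `R(z)` and is returned by the scheme, when the elements
arrive in the order `π 0, π 1, …`. -/
def OnlineCRS.selectProb (ψ : OnlineCRS) {k : ℕ} (z : Fin k → ℝ) (π : Equiv.Perm (Fin k))
    (i : Fin k) : ℝ :=
  ∑ Z : Fin k → Bool, bernProb z Z *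
    expect (ψ k z) (fun R => if Z i = true ∧ SelectionRule.run Z k R π = some i then 1 else 0)

/-- The scheme is an `α`-selectable OCRS: for every (fixed, unknown to the scheme) arrival order,
each element is returned with conditional probability at least `α` given that it is in `R(z)`.
(The conditional probability is meaningful when `z i > 0`.) -/
def OnlineCRS.SelectableAdversarial (ψ : OnlineCRS) (α : ℝ) : Prop :=
  ∀ (k : ℕ) (z : Fin k → ℝ), z ∈ uniformPolytope k → ∀ (π : Equiv.Perm (Fin k)) (i : Fin k),
    0 < z i → α ≤ ψ.selectProb z π i / memProb z i

/-- The scheme is an `α`-selectable RCRS: as before, but the arrival order is uniformly random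
and independent of everything else. -/
def OnlineCRS.SelectableRandomOrder (ψ : OnlineCRS) (α : ℝ) : Prop :=
  ∀ (k : ℕ) (z : Fin k → ℝ), z ∈ uniformPolytope k → ∀ i : Fin k, 0 < z i →
    α ≤ ((∑ π : Equiv.Perm (Fin k), ψ.selectProb z π i) / (k.factorial : ℝ)) / memProb z i

/-! ### Stochastic graphs with probing constraints -/

/-- A stochastic graph on the complete bipartite graph `U × V`: edge probabilities `p`, edge
weights `w`, and for every `v` a downward-closed probing constraint `C v`, a set of strings of
distinct edges at `v`. An edge `(u, v)` at `v` is recorded by its endpoint `u`. The same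
structure serves as a type graph, with `V` the type nodes. -/
structure StochGraph (U V : Type*) where
  p : U → V → ℝ
  w : U → V → ℝ
  C : V → Set (List U)
  p_nonneg : ∀ u v, 0 ≤ p u v
  p_le_one : ∀ u v, p u v ≤ 1
  nodup : ∀ v, ∀ l ∈ C v, l.Nodup
  nil_mem : ∀ v, [] ∈ C v
  substring_mem : ∀ v, ∀ l ∈ C v, ∀ l' : List U, l' <:+: l → l' ∈ C v
  perm_mem : ∀ v, ∀ l ∈ C v, ∀ l' : List U, l'.Perm l → l' ∈ C v

/-- The stochastic graph with vertices `V` in which `v` has type `b v`. -/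
def StochGraph.ofTypes {U B V : Type*} (H : StochGraph U B) (b : V → B) : StochGraph U V where
  p u v := H.p u (b v)
  w u v := H.w u (b v)
  C v := H.C (b v)
  p_nonneg u v := H.p_nonneg u (b v)
  p_le_one u v := H.p_le_one u (b v)
  nodup v := H.nodup (b v)
  nil_mem v := H.nil_mem (b v)
  substring_mem v := H.substring_mem (b v)
  perm_mem v := H.perm_mem (b v)

/-- The weight of a set of edges, listed without repetition. -/
def StochGraph.weight {U V : Type*} (G : StochGraph U V) (M : List (U × V)) : ℝ :=
  (M.map (fun e => G.w e.1 e.2)).sum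

/-- The probability that the edge states are exactly `st`. -/
def StochGraph.stateProb {U V : Type*} [Fintype U] [Fintype V] (G : StochGraph U V)
    (st : U × V → Bool) : ℝ :=
  bernProb (fun e : U × V => G.p e.1 e.2) st

/-- A sequence of probes and a list of accepted edges are feasible if the string of probes at
each `v` belongs to `C v` and the accepted edges form a matching. -/
def StochGraph.Feasible {U V : Type*} [DecidableEq V] (G : StochGraph U V)
    (probes accepted : List (U × V)) : Prop :=
  (∀ v, (probes.filter (fun e => e.2 = v)).map Prod.fst ∈ G.C v) ∧
    accepted.Pairwise (fun e f => e.1 ≠ f.1 ∧ e.2 ≠ f.2)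

/-! ### Adaptive probing in the probe-commit model -/

/-- A deterministic adaptive probing strategy. `probe e take T₁ T₀` probes `e`; if `e` turns out
active, then `e` is accepted or not according to `take`, and only then does the strategy go on
with `T₁`; if `e` is inactive, it goes on with `T₀`. `leaf l` stops with the result `l`. -/
inductive ProbeTree (E : Type*) (L : Type*) where
  | leaf (l : L) : ProbeTree E L
  | probe (e : E) (take : Bool) (ifActive ifInactive : ProbeTree E L) : ProbeTree E L

/-- The list of probes, the list of accepted edges and the result, when the edge states
are `st`. -/
def ProbeTree.run {E L : Type*} (st : E → Bool) : ProbeTree E L → List E × List E × L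
  | .leaf l => ([], [], l)
  | .probe e take T₁ T₀ =>
    if st e then
      (e :: (T₁.run st).1,
        if take then e :: (T₁.run st).2.1 else (T₁.run st).2.1,
        (T₁.run st).2.2)
    else (e :: (T₀.run st).1, (T₀.run st).2.1, (T₀.run st).2.2)

/-! ### The offline adaptive benchmark -/

/-- A (randomized) offline probing algorithm on `G`: a distribution over adaptive probing
strategies each of which is feasible whatever the edge states are. -/
structure OfflineAlg {U V : Type*} [DecidableEq V] (G : StochGraph U V) where
  law : PMF (ProbeTree (U × V) Unit)
  feasible : ∀ T ∈ law.support, ∀ st, G.Feasible (T.run st).1 (T.run st).2.1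

/-- The expected weight of the matching returned by an offline probing algorithm. -/
def OfflineAlg.value {U V : Type*} [Fintype U] [DecidableEq U] [Fintype V] [DecidableEq V]
    {G : StochGraph U V} (A : OfflineAlg G) : ℝ :=
  expect A.law (fun T => ∑ st : U × V → Bool, G.stateProb st * G.weight (T.run st).2.1)

/-- The value `OPT(G)` of the offline adaptive benchmark. -/
def StochGraph.opt {U V : Type*} [Fintype U] [DecidableEq U] [Fintype V] [DecidableEq V]
    (G : StochGraph U V) : ℝ :=
  ⨆ A : OfflineAlg G, A.value

/-! ### Known i.d. inputs and online probing algorithms -/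

/-- A known i.d. input: a type graph and one distribution on the type nodes for each of the `n`
online vertices. -/
structure KnownIDInput (U B : Type*) (n : ℕ) where
  H : StochGraph U B
  D : Fin n → PMF B

/-- The probability that the online vertices have exactly the types `b`. -/
def KnownIDInput.typeProb {U B : Type*} {n : ℕ} (I : KnownIDInput U B n) (b : Fin n → B) : ℝ :=
  ∏ i, (I.D i (b i)).toReal

/-- The benchmark `E[OPT(G)]`, where `G` is drawn from the input. -/
def KnownIDInput.opt {U B : Type*} [Fintype U] [DecidableEq U] [Fintype B] {n : ℕ}
    (I : KnownIDInput U B n) : ℝ :=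
  ∑ b : Fin n → B, I.typeProb b * (I.H.ofTypes b).opt

/-- A deterministic online probing strategy with `t` arrivals to come. On an arrival it learns
the index `i` of the arriving vertex (hence its distribution) and its type, runs a probing
strategy on the edges at that vertex, and, depending on what it saw there, goes on with a strategy
for the remaining arrivals. -/
def OnlineStrategy (U : Type u) (B : Type v) (n : ℕ) : ℕ → Type (max u v)
  | 0 => PUnit
  | t + 1 => Fin n → B → ProbeTree U (OnlineStrategy U B n t)

/-- The list of probes and the list of accepted edges when the vertices `arr 0, arr 1, …` arrive
in this order, with types `b` and edge states `st`. -/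
def OnlineStrategy.run {U B : Type*} {n : ℕ} (b : Fin n → B) (st : U × Fin n → Bool) :
    (t : ℕ) → OnlineStrategy U B n t → (Fin t → Fin n) →
      List (U × Fin n) × List (U × Fin n)
  | 0, _, _ => ([], [])
  | t + 1, A, arr =>
    let i := arr 0
    let r := ProbeTree.run (fun u => st (u, i)) (A i (b i))
    let s := OnlineStrategy.run b st t r.2.2 (fun j => arr j.succ)
    (r.1.map (fun u => (u, i)) ++ s.1, r.2.1.map (fun u => (u, i)) ++ s.2)

/-- A (randomized) online probing strategy for the input `I`: a distribution over deterministic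
strategies each of which is feasible whatever the types, the edge states and the arrival order
are. The arrival order is not known to the strategy in advance. -/
structure RandomizedOnlineStrategy {U B : Type*} {n : ℕ} (I : KnownIDInput U B n) where
  law : PMF (OnlineStrategy U B n n)
  feasible : ∀ A ∈ law.support, ∀ (b : Fin n → B) (st : U × Fin n → Bool)
    (π : Equiv.Perm (Fin n)),
    (I.H.ofTypes b).Feasible (OnlineStrategy.run b st n A π).1 (OnlineStrategy.run b st n A π).2

/-- The expected weight of the matching returned when the vertices arrive in the
order `π 0, π 1, …`; the expectation is over the types, the edge states and the randomness of the
strategy. -/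
def RandomizedOnlineStrategy.value {U B : Type*} [Fintype U] [DecidableEq U] [Fintype B] {n : ℕ}
    {I : KnownIDInput U B n} (A : RandomizedOnlineStrategy I) (π : Equiv.Perm (Fin n)) : ℝ :=
  expect A.law (fun S => ∑ b : Fin n → B, I.typeProb b *
    ∑ st : U × Fin n → Bool, (I.H.ofTypes b).stateProb st *
      (I.H.ofTypes b).weight (OnlineStrategy.run b st n S π).2)

/-- An online probing algorithm for known i.d. instances: given the input, it follows some
randomized online strategy. -/
def OnlineProbingAlg : Type (max (u + 1) (v + 1)) :=
  (U : Type u) → (B : Type v) → [Fintype U] → [DecidableEq U] → [Fintype B] → (n : ℕ) →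
    (I : KnownIDInput U B n) → RandomizedOnlineStrategy I

/-- `α`-competitive for adversarial arrivals: the order is chosen by an oblivious adversary. -/
def OnlineProbingAlg.CompetitiveAdversarial (A : OnlineProbingAlg.{u, v}) (α : ℝ) :
    Prop :=
  ∀ (U : Type u) (B : Type v) [Fintype U] [DecidableEq U] [Fintype B] (n : ℕ)
    (I : KnownIDInput U B n) (π : Equiv.Perm (Fin n)),
    α * I.opt ≤ (A U B n I).value π

/-- `α`-competitive for random order arrivals: the order is uniformly random and independent of
everything else. -/
def OnlineProbingAlg.CompetitiveRandomOrder (A : OnlineProbingAlg.{u, v}) (α : ℝ) :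
    Prop :=
  ∀ (U : Type u) (B : Type v) [Fintype U] [DecidableEq U] [Fintype B] (n : ℕ)
    (I : KnownIDInput U B n),
    α * I.opt ≤ (∑ π : Equiv.Perm (Fin n), (A U B n I).value π) / (n.factorial : ℝ)

end

/-! Fix an optimal offline strategy `T b` for every type vector `b`. When an online vertex `i`
arrives, it draws a private sample of types and edge states for the other vertices and runs `T` on
this sample completed by its own real type: probes at other vertices are answered by the sample,
probes at `i` are real. The first edge of nonnegative weight at `i` that `T` accepts is a proposal
to its endpoint `u`, after which `i` stops probing. The edge is taken exactly when the contention
resolution scheme run at `u`, whose ground set is the set of online vertices, selects `i`.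

Two facts carry the argument. First, the real data of `i` together with its sample have the law of
the input (`sum_prodProb_update`), so `i` proposes to `u` with the probability, and with the
expected weight, that this edge has in the offline matching, negative edges being discarded. As the
offline strategy matches `u` at most once, these probabilities lie in the polytope
(`proposalProb_mem_uniformPolytope`), and the total expected weight of the proposals is at least the
benchmark (`opt_le_sum_proposalGain`).

Second, since samples are private, the proposals to a fixed `u` are independent over `i`, so the
proposing vertices form the random set of the scheme. The scheme sees only these bits; hence, given
that `i` proposes to `u`, its selection is independent of the weight, which depends on the data of
`i` alone (`sum_prodProb_mul_bernProb`). Each expected proposal weight is thus multiplied by a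
conditional selection probability (`exists_strategy`). This is an identity for every arrival order,
so both arrival models follow, the second by averaging. -/

/-! ### Expectations under discrete distributions -/

section Expect

variable {α β : Type*}

/-- A bound on the support suffices because the other terms vanish; this matters for laws of
algorithms, whose members are only known to be feasible on the support. -/
theorem summable_toReal_mul (μ : PMF α) {f : α → ℝ} {M : ℝ} (hf : ∀ a ∈ μ.support, |f a| ≤ M) :
    Summable fun a => (μ a).toReal * f a := by
  have hμ : Summable fun a => (μ a).toReal := ENNReal.summable_toReal μ.tsum_coe_ne_top
  refine Summable.of_norm_bounded (hμ.mul_right M) fun a => ?_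
  rw [Real.norm_eq_abs, abs_mul, abs_of_nonneg ENNReal.toReal_nonneg]
  by_cases ha : a ∈ μ.support
  · exact mul_le_mul_of_nonneg_left (hf a ha) ENNReal.toReal_nonneg
  · simp [(PMF.apply_eq_zero_iff μ a).2 ha]

theorem tsum_toReal_pmf (μ : PMF α) : ∑' a, (μ a).toReal = 1 := by
  rw [← ENNReal.tsum_toReal_eq fun a => μ.apply_ne_top a, μ.tsum_coe, ENNReal.toReal_one]

theorem expect_le_of_forall_le (μ : PMF α) {f : α → ℝ} {M m : ℝ}
    (hM : ∀ a ∈ μ.support, |f a| ≤ M) (hm : ∀ a ∈ μ.support, f a ≤ m) : expect μ f ≤ m := by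
  have hμ : Summable fun a => (μ a).toReal := ENNReal.summable_toReal μ.tsum_coe_ne_top
  calc expect μ f ≤ ∑' a, (μ a).toReal * m := by
        refine (summable_toReal_mul μ hM).tsum_le_tsum (fun a => ?_) (hμ.mul_right m)
        by_cases ha : a ∈ μ.support
        · exact mul_le_mul_of_nonneg_left (hm a ha) ENNReal.toReal_nonneg
        · simp [(PMF.apply_eq_zero_iff μ a).2 ha]
    _ = m := by rw [tsum_mul_right, tsum_toReal_pmf, one_mul]

theorem expect_sum {ι : Type*} (s : Finset ι) (μ : PMF α) {f : ι → α → ℝ} {M : ι → ℝ}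
    (hf : ∀ i ∈ s, ∀ a, |f i a| ≤ M i) :
    expect μ (fun a => ∑ i ∈ s, f i a) = ∑ i ∈ s, expect μ (f i) := by
  unfold expect
  rw [← Summable.tsum_finsetSum fun i hi => summable_toReal_mul μ fun a _ => hf i hi a]
  simp_rw [Finset.mul_sum]

theorem expect_const_mul (μ : PMF α) (c : ℝ) (f : α → ℝ) :
    expect μ (fun a => c * f a) = c * expect μ f := by
  unfold expect
  rw [← tsum_mul_left]
  exact tsum_congr fun a => by ring

theorem expect_map (μ : PMF α) (g : α → β) {f : β → ℝ} {M : ℝ} (hf : ∀ a, |f (g a)| ≤ M) :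
    expect (μ.map g) f = expect μ (fun a => f (g a)) := by
  have hs : Summable fun a => (μ a).toReal * f (g a) := summable_toReal_mul μ fun a _ => hf a
  have hs' := (Equiv.sigmaFiberEquiv g).summable_iff.2 hs
  unfold expect
  rw [← (Equiv.sigmaFiberEquiv g).tsum_eq]
  refine Eq.trans ?_ hs'.tsum_sigma.symm
  refine tsum_congr fun b => ?_
  have h1 : ((μ.map g) b).toReal = ∑' a : {a // g a = b}, (μ a).toReal := by
    rw [PMF.map_apply, ← ENNReal.tsum_toReal_eq fun a : {a // g a = b} => μ.apply_ne_top a]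
    congr 1
    have := tsum_subtype {a | g a = b} (fun a => μ a)
    rw [show (∑' a : {a // g a = b}, μ a) = ∑' a : ({a | g a = b} : Set α), μ a from rfl, this]
    refine tsum_congr fun a => ?_
    by_cases h : g a = b
    · simp [h]
    · simp [h, Ne.symm h]
  rw [h1, ← tsum_mul_right]
  refine tsum_congr fun a => ?_
  simp [Equiv.sigmaFiberEquiv, a.2]

theorem expect_bind_fintype [Fintype α] (μ : PMF α) (κ : α → PMF β) {f : β → ℝ}
    (hf : ∀ a, Summable fun b => (κ a b).toReal * f b) :
    expect (μ.bind κ) f = ∑ a, (μ a).toReal * expect (κ a) f := by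
  unfold expect
  simp_rw [← tsum_mul_left]
  rw [← Summable.tsum_finsetSum fun a _ => (hf a).mul_left _]
  refine tsum_congr fun b => ?_
  rw [PMF.bind_apply, tsum_fintype,
    ENNReal.toReal_sum fun a _ => ENNReal.mul_ne_top (μ.apply_ne_top a) ((κ a).apply_ne_top b),
    Finset.sum_mul]
  exact Finset.sum_congr rfl fun a _ => by rw [ENNReal.toReal_mul, mul_assoc]

/-- Finitely many distributions on the same type have a coupling. -/
theorem PMF.exists_coupling {ι : Type*} [Finite ι] [Nonempty α] (P : ι → PMF α) :
    ∃ μ : PMF (ι → α), ∀ i, μ.map (fun f => f i) = P i := by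
  classical
  have := Fintype.ofFinite ι
  suffices h : ∀ s : Finset ι, ∃ μ : PMF (ι → α), ∀ i ∈ s, μ.map (fun f => f i) = P i by
    obtain ⟨μ, hμ⟩ := h Finset.univ
    exact ⟨μ, fun i => hμ i (Finset.mem_univ i)⟩
  intro s
  induction s using Finset.induction_on with
  | empty => exact ⟨PMF.pure fun _ => Classical.arbitrary α, by simp⟩
  | insert a s ha ih =>
    obtain ⟨μ, hμ⟩ := ih
    -- Coordinate `a` is redrawn independently from `P a`; the marginals already arranged on `s` are
    -- untouched.
    refine ⟨μ.bind fun f => (P a).map fun x => Function.update f a x, fun i hi => ?_⟩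
    rw [PMF.map_bind]
    simp_rw [PMF.map_comp]
    by_cases hia : i = a
    · subst hia
      simp only [Function.comp_def, Function.update_self]
      exact (PMF.bind_const μ _).trans (PMF.map_id _)
    · have hc : ∀ f : ι → α, ((fun f : ι → α => f i) ∘ fun x => Function.update f a x) =
          Function.const α (f i) := by
        intro f; ext x; simp [hia]
      simp_rw [hc, PMF.map_const]
      exact hμ i (Finset.mem_of_mem_insert_of_ne hi hia)

end Expect

/-! ### Optimal offline strategies -/

theorem StochGraph.Feasible.nodup_accepted {U V : Type*} [DecidableEq V] {G : StochGraph U V}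
    {probes accepted : List (U × V)} (h : G.Feasible probes accepted) : accepted.Nodup :=
  h.2.imp fun hef hne => hef.1 (congrArg Prod.fst hne)

/-- The value of a tree depends only on the map from edge states to accepted lists. Accepted lists
have no repetitions, so there are finitely many such maps and a best one exists; randomizing over
trees cannot beat it. -/
theorem StochGraph.exists_optimal_probeTree {U V : Type*} [Fintype U] [DecidableEq U] [Fintype V]
    [DecidableEq V] (G : StochGraph U V) :
    ∃ T : ProbeTree (U × V) Unit, (∀ st, G.Feasible (T.run st).1 (T.run st).2.1) ∧
      G.opt ≤ ∑ st : U × V → Bool, G.stateProb st * G.weight (T.run st).2.1 := by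
  let S : Set (ProbeTree (U × V) Unit) :=
    {T | ∀ st, G.Feasible (T.run st).1 (T.run st).2.1}
  let acc : ProbeTree (U × V) Unit → (U × V → Bool) → List (U × V) := fun T st => (T.run st).2.1
  let val : ((U × V → Bool) → List (U × V)) → ℝ := fun a => ∑ st, G.stateProb st * G.weight (a st)
  have hleaf : ProbeTree.leaf () ∈ S := fun st => by
    refine ⟨fun v => ?_, ?_⟩ <;> simp [ProbeTree.run, G.nil_mem]
  have hfin : (acc '' S).Finite := by
    have hN : {l : List (U × V) | l.Nodup}.Finite :=
      @Set.toFinite _ _ (inferInstanceAs (Finite {l : List (U × V) // l.Nodup}))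
    refine (Set.Finite.pi' fun _ : U × V → Bool => hN).subset ?_
    rintro _ ⟨T, hT, rfl⟩ st
    exact (hT st).nodup_accepted
  have hne : (acc '' S).Nonempty := ⟨_, _, hleaf, rfl⟩
  obtain ⟨_, ⟨T, hT, rfl⟩, hmax⟩ := Set.exists_max_image _ val hfin hne
  -- A uniform bound on the values, needed for the summability of the expectation.
  obtain ⟨_, _, hM⟩ := Set.exists_max_image _ (fun a => |val a|) hfin hne
  refine ⟨T, hT, ?_⟩
  have : Nonempty (OfflineAlg G) := ⟨⟨PMF.pure (.leaf ()), fun T hT => by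
    rw [PMF.support_pure, Set.mem_singleton_iff] at hT
    exact hT ▸ hleaf⟩⟩
  refine ciSup_le fun A => ?_
  exact expect_le_of_forall_le A.law (fun T' h' => hM _ ⟨T', A.feasible T' h', rfl⟩)
    fun T' h' => hmax _ ⟨T', A.feasible T' h', rfl⟩

/-! ### Restricting an offline strategy to one vertex -/

namespace ProbeTree

/-- The behaviour at `v` of an offline strategy when the states of the edges at the other vertices
are given by `st`, stopped at the first active edge which satisfies `ok` and is accepted. This edge
is the result. -/
def localize {U V : Type*} [DecidableEq V] (v : V) (ok : U → Bool) (st : U × V → Bool) :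
    ProbeTree (U × V) Unit → ProbeTree U (Option U)
  | .leaf _ => .leaf none
  | .probe e take T₁ T₀ =>
    if e.2 = v then
      .probe e.1 (take && ok e.1)
        (if take && ok e.1 then .leaf (some e.1) else localize v ok st T₁) (localize v ok st T₀)
    else if st e then localize v ok st T₁ else localize v ok st T₀

/-- Accept only the edges which satisfy `g`, and relabel the leaves. -/
def gate {E R L : Type*} (g : E → Bool) (next : R → L) : ProbeTree E R → ProbeTree E L
  | .leaf r => .leaf (next r)
  | .probe e take T₁ T₀ => .probe e (take && g e) (gate g next T₁) (gate g next T₀)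

/-- Refusing an edge does not alter the course of the run, so proposals are independent of the
decisions of the selection rules. -/
theorem run_gate {E R L : Type*} (g : E → Bool) (next : R → L) (st : E → Bool)
    (T : ProbeTree E R) :
    (T.gate g next).run st =
      ((T.run st).1, (T.run st).2.1.filter g, next (T.run st).2.2) := by
  induction T with
  | leaf r => simp [gate, run]
  | probe e take T₁ T₀ h₁ h₀ =>
    simp only [gate, run, h₁, h₀]
    cases st e <;> cases take <;> cases hg : g e <;> simp [hg]

section localize

variable {U V : Type*} [DecidableEq V] (v : V) (ok : U → Bool)

/-- The localized tree accepts an edge only at the moment when it stops with that edge as its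
result. -/
theorem accepted_localize (st : U × V → Bool) (σ : U → Bool) (T : ProbeTree (U × V) Unit) :
    ((T.localize v ok st).run σ).2.1 = ((T.localize v ok st).run σ).2.2.toList := by
  induction T with
  | leaf r => simp [localize, run]
  | probe e take T₁ T₀ h₁ h₀ =>
    simp only [localize]
    split_ifs with h h' h' <;> simp_all [run]
    all_goals split_ifs <;> simp_all

variable {st st' : U × V → Bool} (hst : ∀ e, e.2 ≠ v → st e = st' e) (T : ProbeTree (U × V) Unit)
include hst

/-- Here `st'` is the mixed instance: real states at `v`, simulated states elsewhere. The localized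
run follows the offline run on `st'` up to the first acceptable edge at `v`. -/
theorem result_localize :
    ((T.localize v ok st).run fun u => st' (u, v)).2.2 =
      ((T.run st').2.1.find? fun e => e.2 = v && ok e.1).map Prod.fst := by
  induction T with
  | leaf r => simp [localize, run]
  | probe e take T₁ T₀ h₁ h₀ =>
    obtain ⟨x, y⟩ := e
    by_cases h : y = v
    · subst h
      cases hs : st' (x, y) <;> cases take <;> cases ho : ok x <;>
        simp [localize, run, hs, ho, h₁, h₀]
    · have := hst (x, y) h
      cases hs : st' (x, y) <;> cases take <;> simp [localize, run, hs, h, h₁, h₀, this]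

/-- Only a prefix is obtained, because the localized run stops at the proposal while the offline run
may go on probing at `v`. -/
theorem probes_localize :
    ((T.localize v ok st).run fun u => st' (u, v)).1 <+:
      ((T.run st').1.filter fun e => e.2 = v).map Prod.fst := by
  induction T with
  | leaf r => simp [localize, run]
  | probe e take T₁ T₀ h₁ h₀ =>
    obtain ⟨x, y⟩ := e
    by_cases h : y = v
    · subst h
      cases hs : st' (x, y) <;> cases take <;> cases ho : ok x <;>
        simp [localize, run, hs, ho, h₁, h₀]
    · have := hst (x, y) h
      cases hs : st' (x, y) <;> simp [localize, run, hs, h, h₁, h₀, this]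

end localize

end ProbeTree

/-! ### The online strategy -/

section Strategy

variable {U : Type u} {B : Type v} [DecidableEq U] {n : ℕ}

/-- The state of a selection rule after the arrival of `i` with the given bit: `none` means that
an element has been returned. -/
def SelectionRule.step {t : ℕ} (i : Fin n) (bit : Bool) (R : SelectionRule n (t + 1)) :
    Option (SelectionRule n t) :=
  if bit && (R i bit).1 then none else some (R i bit).2

/-- The online strategy in which the arriving vertex runs its own probing strategy, which proposes
to at most one `u`, and the selection rule of `u` decides on the proposal. -/
def OnlineStrategy.ofRules (loc : Fin n → B → ProbeTree U (Option U)) :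
    (t : ℕ) → (U → Option (SelectionRule n t)) → OnlineStrategy U B n t
  | 0, _ => PUnit.unit
  | t + 1, s => fun i β =>
    (loc i β).gate (fun u => (s u).any fun R => (R i true).1)
      fun o => OnlineStrategy.ofRules loc t fun u => (s u).bind (SelectionRule.step i (o = some u))

variable (loc : Fin n → B → ProbeTree U (Option U)) (b : Fin n → B) (st : U × Fin n → Bool)

/-- The vertex `u` to which the online vertex `i` proposes. -/
def proposal (i : Fin n) : Option U :=
  ((loc i (b i)).run fun u => st (u, i)).2.2

/-- The outcome of the selection rule of `u`, starting from the state `s`. -/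
def selected (u : U) {t : ℕ} (s : Option (SelectionRule n t)) (arr : Fin t → Fin n) :
    Option (Fin n) :=
  s.bind fun R => SelectionRule.run (fun i => proposal loc b st i = some u) t R arr

variable (hloc : ∀ i β σ, ((loc i β).run σ).2.1 = ((loc i β).run σ).2.2.toList)

theorem OnlineStrategy.run_ofRules_succ (t : ℕ) (s : U → Option (SelectionRule n (t + 1)))
    (arr : Fin (t + 1) → Fin n) :
    OnlineStrategy.run b st (t + 1) (OnlineStrategy.ofRules loc (t + 1) s) arr =
      let r := OnlineStrategy.run b st t (OnlineStrategy.ofRules loc t fun u =>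
        (s u).bind (SelectionRule.step (arr 0) (proposal loc b st (arr 0) = some u)))
        fun j => arr j.succ
      (((loc (arr 0) (b (arr 0))).run fun u => st (u, arr 0)).1.map (fun u => (u, arr 0)) ++ r.1,
       (((loc (arr 0) (b (arr 0))).run fun u => st (u, arr 0)).2.1.filter
          fun u => (s u).any fun R => (R (arr 0) true).1).map (fun u => (u, arr 0)) ++ r.2) := by
  simp only [OnlineStrategy.run, OnlineStrategy.ofRules, ProbeTree.run_gate]
  rfl

/-- Matches the recursion of a selection rule with that of the online strategy; the decision is
queried at the bit `true`, the only case in which it matters. -/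
theorem selected_succ (u : U) (t : ℕ) (s : Option (SelectionRule n (t + 1)))
    (arr : Fin (t + 1) → Fin n) :
    selected loc b st u s arr =
      if proposal loc b st (arr 0) = some u ∧ s.any (fun R => (R (arr 0) true).1) then some (arr 0)
      else selected loc b st u
        (s.bind (SelectionRule.step (arr 0) (proposal loc b st (arr 0) = some u)))
        fun j => arr j.succ := by
  cases s with
  | none => simp [selected]
  | some R =>
    by_cases h : proposal loc b st (arr 0) = some u <;>
      simp [selected, SelectionRule.run, SelectionRule.step, h]
    cases (R (arr 0) true).1 <;> simp

theorem mem_range_of_mem_probes (t : ℕ) (s : U → Option (SelectionRule n t))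
    (arr : Fin t → Fin n) (e : U × Fin n)
    (he : e ∈ (OnlineStrategy.run b st t (OnlineStrategy.ofRules loc t s) arr).1) :
    e.2 ∈ Set.range arr := by
  induction t with
  | zero => simp [OnlineStrategy.run] at he
  | succ t ih =>
    rw [OnlineStrategy.run_ofRules_succ] at he
    rcases List.mem_append.1 he with he | he
    · obtain ⟨u, -, rfl⟩ := List.mem_map.1 he
      exact ⟨0, rfl⟩
    · obtain ⟨j, hj⟩ := ih _ _ he
      exact ⟨j.succ, hj⟩

theorem probes_ofRules (t : ℕ) (s : U → Option (SelectionRule n t)) (arr : Fin t → Fin n)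
    (harr : Function.Injective arr) (v : Fin n) :
    ((OnlineStrategy.run b st t (OnlineStrategy.ofRules loc t s) arr).1.filter
      fun e => e.2 = v).map Prod.fst = [] ∨
    ((OnlineStrategy.run b st t (OnlineStrategy.ofRules loc t s) arr).1.filter
      fun e => e.2 = v).map Prod.fst = ((loc v (b v)).run fun u => st (u, v)).1 := by
  induction t with
  | zero => left; simp [OnlineStrategy.run]
  | succ t ih =>
    have harr' : Function.Injective fun j : Fin t => arr j.succ :=
      harr.comp (Fin.succ_injective t)
    have hmem := mem_range_of_mem_probes loc b st t
      (fun u => (s u).bind (SelectionRule.step (arr 0) (proposal loc b st (arr 0) = some u)))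
      fun j => arr j.succ
    rw [OnlineStrategy.run_ofRules_succ]
    simp only [List.filter_append, List.map_append]
    -- If `v` arrives now, injectivity of the order excludes any later probe at `v`.
    by_cases hv : arr 0 = v
    · right
      subst hv
      rw [List.filter_eq_nil_iff (l := (OnlineStrategy.run _ _ _ _ _).1).2]
      · simp [List.filter_map, Function.comp_def]
      · intro e he
        obtain ⟨j, hj⟩ := hmem e he
        simpa [← hj] using fun h => Fin.succ_ne_zero j (harr h)
    · simpa [List.filter_map, Function.comp_def, hv] using ih _ _ harr'

include hloc

/-- Ensures that a vertex whose rule has already returned an element, recorded by the state `none`,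
is never matched again. -/
theorem mem_of_mem_accepted (t : ℕ) (s : U → Option (SelectionRule n t))
    (arr : Fin t → Fin n) (e : U × Fin n)
    (he : e ∈ (OnlineStrategy.run b st t (OnlineStrategy.ofRules loc t s) arr).2) :
    (s e.1).isSome ∧ e.2 ∈ Set.range arr := by
  induction t with
  | zero => simp [OnlineStrategy.run] at he
  | succ t ih =>
    rw [OnlineStrategy.run_ofRules_succ] at he
    rcases List.mem_append.1 he with he | he
    · obtain ⟨u, hu, rfl⟩ := List.mem_map.1 he
      have := (List.mem_filter.1 hu).2
      refine ⟨?_, 0, rfl⟩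
      cases hs : s u <;> simp_all
    · obtain ⟨h, j, hj⟩ := ih _ _ he
      refine ⟨?_, j.succ, hj⟩
      cases hs : s e.1 <;> simp_all

theorem pairwise_accepted (t : ℕ) (s : U → Option (SelectionRule n t))
    (arr : Fin t → Fin n) (harr : Function.Injective arr) :
    (OnlineStrategy.run b st t (OnlineStrategy.ofRules loc t s) arr).2.Pairwise
      fun e f => e.1 ≠ f.1 ∧ e.2 ≠ f.2 := by
  induction t with
  | zero => simp [OnlineStrategy.run]
  | succ t ih =>
    have harr' : Function.Injective fun j : Fin t => arr j.succ :=
      harr.comp (Fin.succ_injective t)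
    rw [OnlineStrategy.run_ofRules_succ]
    refine List.pairwise_append.2 ⟨?_, ih _ _ harr', fun e he f hf => ?_⟩
    · rw [hloc]
      cases ((loc (arr 0) (b (arr 0))).run fun u => st (u, arr 0)).2.2 with
      | none => simp
      | some u =>
        by_cases hg : (s u).any (fun R => (R (arr 0) true).1) <;> simp [hg]
    · obtain ⟨u, hu, rfl⟩ := List.mem_map.1 he
      obtain ⟨hu, hg⟩ := List.mem_filter.1 hu
      rw [hloc, ← proposal, Option.mem_toList] at hu
      obtain ⟨hf, j, hj⟩ := mem_of_mem_accepted loc b st hloc t _ _ f hf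
      refine ⟨?_, fun h => Fin.succ_ne_zero j (harr (hj.trans h.symm))⟩
      rintro rfl
      cases hs : s f.1 <;> simp_all [SelectionRule.step]

/-- Turns the weight of the matching into a sum over `u` of separate contention resolution problems,
each driven by the proposals to `u`. -/
theorem sum_accepted_ofRules [Fintype U] (w : U → Fin n → ℝ) (t : ℕ)
    (s : U → Option (SelectionRule n t)) (arr : Fin t → Fin n) :
    ((OnlineStrategy.run b st t (OnlineStrategy.ofRules loc t s) arr).2.map
      fun e => w e.1 e.2).sum = ∑ u, (selected loc b st u (s u) arr).elim 0 (w u) := by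
  induction t with
  | zero =>
    have : ∀ u, selected loc b st u (s u) arr = none := fun u => by
      cases h : s u <;> simp [selected, SelectionRule.run]
    simp [OnlineStrategy.run, this]
  | succ t ih =>
    rw [OnlineStrategy.run_ofRules_succ]
    simp only [List.map_append, List.sum_append, ih, hloc, selected_succ]
    rw [← proposal]
    have hsplit : ∀ u, (selected loc b st u (s u) arr).elim 0 (w u) =
      (if proposal loc b st (arr 0) = some u ∧ (s u).any (fun R => (R (arr 0) true).1) then
        w u (arr 0) else 0) + (selected loc b st u
        ((s u).bind (SelectionRule.step (arr 0) (proposal loc b st (arr 0) = some u)))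
        fun j => arr j.succ).elim 0 (w u) := by
      intro u
      rw [selected_succ]
      split_ifs with h
      -- Once the rule of `u` accepts, its state becomes `none`, so the later term vanishes.
      · obtain ⟨h, h'⟩ := h
        cases hs : s u with
        | none => simp [hs] at h'
        | some R =>
          simp only [hs, Option.any_some] at h'
          simp [SelectionRule.step, h, h', selected]
      · simp
    simp only [← selected_succ, hsplit, Finset.sum_add_distrib]
    congr 1
    cases ho : proposal loc b st (arr 0) with
    | none => simp
    | some u₀ =>
      rw [Finset.sum_eq_single u₀ (fun u _ h => by simp [Ne.symm h]) (by simp)]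
      by_cases hg : (s u₀).any (fun R => (R (arr 0) true).1) <;> simp [hg]

end Strategy

/-! ### Finite product distributions -/

section ProdProb

variable {ι Ω : Type*} [Fintype ι]

/-- The probability of `ω` when its coordinates are independent with the distributions `q`. -/
def prodProb (q : ι → Ω → ℝ) (ω : ι → Ω) : ℝ :=
  ∏ i, q i (ω i)

theorem prodProb_nonneg {q : ι → Ω → ℝ} (hq : ∀ i x, 0 ≤ q i x) (ω : ι → Ω) : 0 ≤ prodProb q ω :=
  Finset.prod_nonneg fun i _ => hq i _

variable [DecidableEq ι] [Fintype Ω] {q : ι → Ω → ℝ}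

theorem sum_prodProb (hsum : ∀ i, ∑ x, q i x = 1) : ∑ ω, prodProb q ω = 1 := by
  unfold prodProb
  rw [← Fintype.prod_sum]
  exact Finset.prod_eq_one fun i _ => hsum i

/-- Resampling one coordinate does not change the distribution. -/
theorem sum_prodProb_update (hsum : ∀ i, ∑ x, q i x = 1) (i : ι) (h : (ι → Ω) → ℝ) :
    ∑ ω : (ι → Ω) × Ω, prodProb q ω.1 * q i ω.2 * h (Function.update ω.1 i ω.2) =
      ∑ ω, prodProb q ω * h ω := by
  -- Exchanging coordinate `i` with the extra copy preserves the weight, since both have the law `q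
  -- i`; the exchanged-out coordinate then sums to one.
  have hinv : Function.Involutive fun ω : (ι → Ω) × Ω => (Function.update ω.1 i ω.2, ω.1 i) := by
    rintro ⟨ω, x⟩
    simp
  rw [← Equiv.sum_comp (Function.Involutive.toPerm _ hinv), Fintype.sum_prod_type]
  refine Finset.sum_congr rfl fun ω _ => ?_
  rw [← mul_one (prodProb q ω * h ω), ← hsum i, Finset.mul_sum]
  refine Finset.sum_congr rfl fun x _ => ?_
  simp only [Function.Involutive.coe_toPerm, Function.update_idem, Function.update_eq_self]
  have h1 : prodProb q (Function.update ω i x) * q i (ω i) = prodProb q ω * q i x := by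
    unfold prodProb
    rw [← Finset.mul_prod_erase _ _ (Finset.mem_univ i),
      ← Finset.mul_prod_erase (a := i) Finset.univ (fun j => q j (ω j)) (Finset.mem_univ i),
      Finset.prod_congr rfl (g := fun j => q j (ω j)) fun j hj => by
        rw [Function.update_of_ne (Finset.ne_of_mem_erase hj)]]
    simp only [Function.update_self]
    ring
  rw [h1]
  ring

theorem sum_prodProb_coord (hsum : ∀ i, ∑ x, q i x = 1) (i : ι) (g : Ω → ℝ) :
    ∑ ω, prodProb q ω * g (ω i) = ∑ x, q i x * g x := by
  rw [← sum_prodProb_update hsum i fun ω => g (ω i), Fintype.sum_prod_type]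
  simp only [Function.update_self, mul_assoc, ← Finset.mul_sum]
  rw [← Finset.sum_mul, sum_prodProb hsum, one_mul]

/-- The conditional law of a function of independent events `E j`, given an event which is part
of `E i`, is the same as given `E i`. -/
theorem sum_prodProb_mul_bernProb (hsum : ∀ i, ∑ x, q i x = 1) (E : ι → Ω → Bool) (i : ι)
    (g : Ω → ℝ) (hg : ∀ x, E i x = false → g x = 0) (F : (ι → Bool) → ℝ)
    (hF : ∀ Z, Z i = false → F Z = 0) (z : ι → ℝ)
    (hz : ∀ j, z j = ∑ x, q j x * if E j x then 1 else 0) :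
    z i * ∑ ω, prodProb q ω * (g (ω i) * F fun j => E j (ω j)) =
      (∑ Z, bernProb z Z * F Z) * ∑ x, q i x * g x := by
  have hbit : ∀ j (c : Bool),
      ∑ x, q j x * (if E j x = c then 1 else 0) = if c then z j else 1 - z j := by
    intro j c
    cases c with
    | true => simp [hz]
    | false =>
      simp only [Bool.false_eq_true, if_false]
      rw [hz, eq_sub_iff_add_eq, ← Finset.sum_add_distrib]
      refine Eq.trans ?_ (hsum j)
      exact Finset.sum_congr rfl fun x _ => by cases E j x <;> simp
  -- For a fixed bit pattern the sum factorizes over the coordinates, and only the factor at `i`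
  -- involves `g`.
  have hfib : ∀ Z : ι → Bool, ∑ ω, prodProb q ω * (g (ω i) * if (fun j => E j (ω j)) = Z then 1 else 0) =
      (∑ x, q i x * (if E i x = Z i then 1 else 0) * g x) *
        ∏ j ∈ Finset.univ.erase i, if Z j then z j else 1 - z j := by
    intro Z
    have : ∀ ω : ι → Ω,
        prodProb q ω * (g (ω i) * if (fun j => E j (ω j)) = Z then 1 else 0) =
        ∏ j, q j (ω j) * (if E j (ω j) = Z j then 1 else 0) * if j = i then g (ω j) else 1 := by
      intro ω
      rw [Finset.prod_mul_distrib, Finset.prod_mul_distrib, Finset.prod_ite_eq' Finset.univ i]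
      simp only [funext_iff, prodProb, Finset.mem_univ, if_true, Finset.prod_ite_zero,
        Finset.prod_const_one, true_imp_iff]
      ring
    simp_rw [this]
    rw [← Fintype.prod_sum fun j x =>
      q j x * (if E j x = Z j then 1 else 0) * if j = i then g x else 1,
      ← Finset.mul_prod_erase _ _ (Finset.mem_univ i)]
    congr 1
    · simp
    · refine Finset.prod_congr rfl fun j hj => ?_
      rw [← hbit]
      simp [Finset.ne_of_mem_erase hj]
  have hsplit : ∀ ω : ι → Ω, prodProb q ω * (g (ω i) * F fun j => E j (ω j)) =
      ∑ Z, F Z * (prodProb q ω * (g (ω i) * if (fun j => E j (ω j)) = Z then 1 else 0)) := by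
    intro ω
    rw [Finset.sum_eq_single fun j => E j (ω j)]
    · simp only [if_true]; ring
    · intro Z _ hZ
      simp [Ne.symm hZ]
    · simp
  simp_rw [hsplit]
  rw [Finset.sum_comm, Finset.mul_sum, Finset.sum_mul]
  refine Finset.sum_congr rfl fun Z _ => ?_
  rw [← Finset.mul_sum, hfib]
  cases hZ : Z i with
  | false => simp [hF Z hZ]
  | true =>
    -- As `g` vanishes off `E i`, the indicator at `i` is redundant; the factor `z i` on the left
    -- then completes the remaining product to `bernProb z Z`.
    have hg' : ∀ x, q i x * (if E i x = true then 1 else 0) * g x = q i x * g x := by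
      intro x
      cases h : E i x <;> simp [hg x, h]
    simp_rw [hg']
    rw [bernProb, ← Finset.mul_prod_erase _ _ (Finset.mem_univ i), hZ]
    simp only [if_true]
    ring

end ProdProb

/-! ### Bernoulli vectors -/

theorem bernProb_nonneg {ι : Type*} [Fintype ι] {z : ι → ℝ} (h0 : ∀ i, 0 ≤ z i)
    (h1 : ∀ i, z i ≤ 1) (Z : ι → Bool) : 0 ≤ bernProb z Z :=
  Finset.prod_nonneg fun i _ => by
    split_ifs
    exacts [h0 i, sub_nonneg.2 (h1 i)]

theorem bernProb_eq_prodProb {ι : Type*} [Fintype ι] (z : ι → ℝ) :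
    bernProb z = prodProb fun i (c : Bool) => if c then z i else 1 - z i :=
  rfl

theorem sum_bernProb {ι : Type*} [Fintype ι] [DecidableEq ι] (z : ι → ℝ) :
    ∑ Z, bernProb z Z = 1 := by
  rw [bernProb_eq_prodProb]
  exact sum_prodProb fun i => by simp

theorem memProb_eq {k : ℕ} (z : Fin k → ℝ) (i : Fin k) : memProb z i = z i := by
  have := sum_prodProb_coord (q := fun i (c : Bool) => if c then z i else 1 - z i)
    (fun i => by simp) i fun c => if c then 1 else 0
  rw [memProb, bernProb_eq_prodProb, this]
  simp

/-- A distribution on a finite type with given real probabilities. -/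
theorem PMF.exists_of_sum_eq_one {α : Type*} [Fintype α] {f : α → ℝ} (h0 : ∀ a, 0 ≤ f a)
    (h1 : ∑ a, f a = 1) : ∃ μ : PMF α, ∀ a, (μ a).toReal = f a :=
  ⟨PMF.ofFintype (fun a => ENNReal.ofReal (f a)) (by
    rw [← ENNReal.ofReal_sum_of_nonneg fun a _ => h0 a, h1, ENNReal.ofReal_one]),
    fun a => by rw [PMF.ofFintype_apply, ENNReal.toReal_ofReal (h0 a)]⟩

/-! ### The law of a known i.d. input -/

namespace KnownIDInput

variable {U : Type u} {B : Type v} [Fintype U] [DecidableEq U] [Fintype B] {n : ℕ}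
  (I : KnownIDInput U B n)

/-- The probability that the online vertex `i` has the type `x.1` and the edges at `i` have the
states `x.2`. -/
def vertexProb (i : Fin n) (x : B × (U → Bool)) : ℝ :=
  (I.D i x.1).toReal * bernProb (fun u => I.H.p u x.1) x.2

omit [DecidableEq U] [Fintype B] in
theorem vertexProb_nonneg (i : Fin n) (x : B × (U → Bool)) : 0 ≤ I.vertexProb i x :=
  mul_nonneg ENNReal.toReal_nonneg
    (bernProb_nonneg (fun _ => I.H.p_nonneg _ _) (fun _ => I.H.p_le_one _ _) _)

theorem sum_vertexProb (i : Fin n) : ∑ x, I.vertexProb i x = 1 := by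
  simp only [vertexProb, Fintype.sum_prod_type, ← Finset.mul_sum, sum_bernProb, mul_one]
  rw [← tsum_fintype (L := .unconditional _), tsum_toReal_pmf]

end KnownIDInput

/-- The states of all the edges, given the states at each vertex. -/
def edgeStates {U B V : Type*} (x : V → B × (U → Bool)) (e : U × V) : Bool :=
  (x e.2).2 e.1

namespace KnownIDInput

variable {U : Type u} {B : Type v} [Fintype U] [DecidableEq U] [Fintype B] {n : ℕ}
  (I : KnownIDInput U B n)

/-- Regroups types and edge states by online vertex, so that all the data at one vertex form a
single coordinate of a product law. -/
theorem sum_typeProb_stateProb (F : (Fin n → B) → (U × Fin n → Bool) → ℝ) :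
    ∑ b, I.typeProb b * ∑ st, (I.H.ofTypes b).stateProb st * F b st =
      ∑ x, prodProb I.vertexProb x * F (fun i => (x i).1) (edgeStates x) := by
  let eq : (Fin n → B × (U → Bool)) ≃ (Fin n → B) × (U × Fin n → Bool) :=
    (Equiv.arrowProdEquivProdArrow _ _ _).trans (Equiv.prodCongr (Equiv.refl _)
      ((Equiv.piComm _).trans (Equiv.curry _ _ _).symm))
  simp_rw [Finset.mul_sum]
  rw [← Fintype.sum_prod_type' (f := fun b st =>
    I.typeProb b * ((I.H.ofTypes b).stateProb st * F b st)), ← eq.sum_comp]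
  refine Finset.sum_congr rfl fun x _ => ?_
  rw [← mul_assoc]
  refine congrArg₂ _ ?_ rfl
  simp only [typeProb, StochGraph.stateProb, prodProb, vertexProb, bernProb, StochGraph.ofTypes,
    Fintype.prod_prod_type_right, Finset.prod_mul_distrib]
  rfl

end KnownIDInput

/-! ### Proposals along an offline strategy -/

namespace KnownIDInput

variable {U : Type u} {B : Type v} [Fintype U] [DecidableEq U] [Fintype B] {n : ℕ}
  (I : KnownIDInput U B n) (T : (Fin n → B) → ProbeTree (U × Fin n) Unit)

/-- The edges accepted by the offline strategy for the types that are given by `x`. -/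
def offlineAccepted (x : Fin n → B × (U → Bool)) : List (U × Fin n) :=
  ((T fun i => (x i).1).run (edgeStates x)).2.1

/-- The vertex to which the online vertex `i` is matched by the offline strategy, if the weight of
this edge is nonnegative. -/
noncomputable def offlinePartner (x : Fin n → B × (U → Bool)) (i : Fin n) : Option U :=
  ((offlineAccepted T x).find? fun e => e.2 = i && decide (0 ≤ I.H.w e.1 (x i).1)).map Prod.fst

/-- The online vertex `i` of type `β` simulates the offline strategy with the types and the edge
states of the other vertices taken from `y`. -/
noncomputable def simulate (y : Fin n → B × (U → Bool)) (i : Fin n) (β : B) : ProbeTree U (Option U) :=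
  (T (Function.update (fun j => (y j).1) i β)).localize i (fun u => decide (0 ≤ I.H.w u β))
    (edgeStates y)

omit [Fintype U] [DecidableEq U] [Fintype B] in
theorem types_update (y : Fin n → B × (U → Bool)) (i : Fin n) (x : B × (U → Bool)) :
    (fun j => (Function.update y i x j).1) = Function.update (fun j => (y j).1) i x.1 := by
  ext j
  by_cases h : j = i
  · subst h; simp
  · simp [h]

omit [Fintype U] [DecidableEq U] [Fintype B] in
theorem edgeStates_update_of_ne (y : Fin n → B × (U → Bool)) (i : Fin n) (x : B × (U → Bool))
    (e : U × Fin n) (he : e.2 ≠ i) : edgeStates y e = edgeStates (Function.update y i x) e := by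
  simp [edgeStates, he]

omit [Fintype U] [DecidableEq U] [Fintype B] in
theorem edgeStates_update_self (y : Fin n → B × (U → Bool)) (i : Fin n) (x : B × (U → Bool)) :
    (fun u => edgeStates (Function.update y i x) (u, i)) = x.2 := by
  simp [edgeStates]

omit [Fintype U] [DecidableEq U] [Fintype B] in
theorem result_simulate (y : Fin n → B × (U → Bool)) (i : Fin n) (x : B × (U → Bool)) :
    ((I.simulate T y i x.1).run x.2).2.2 = I.offlinePartner T (Function.update y i x) i := by
  have := ProbeTree.result_localize i (fun u => decide (0 ≤ I.H.w u x.1))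
    (edgeStates_update_of_ne y i x) (T (Function.update (fun j => (y j).1) i x.1))
  rw [edgeStates_update_self] at this
  simp only [simulate, this, offlinePartner, offlineAccepted, types_update, Function.update_self]

omit [Fintype U] [DecidableEq U] [Fintype B] in
theorem nonneg_of_offlinePartner {x : Fin n → B × (U → Bool)} {i : Fin n} {u : U}
    (h : I.offlinePartner T x i = some u) : (u, i) ∈ offlineAccepted T x ∧ 0 ≤ I.H.w u (x i).1 := by
  obtain ⟨e, he, rfl⟩ := Option.map_eq_some_iff.1 h
  have h1 := List.find?_some he
  simp only [Bool.and_eq_true, decide_eq_true_eq] at h1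
  exact ⟨h1.1 ▸ List.mem_of_find?_eq_some he, h1.2⟩

variable {T} (hT : ∀ b st, (I.H.ofTypes b).Feasible ((T b).run st).1 ((T b).run st).2.1)
include hT

omit [Fintype U] [DecidableEq U] [Fintype B] in
-- The mixed instance is itself an instance on which `T` is feasible, and the probing constraints
-- are closed under prefixes.
theorem probes_simulate_mem (y : Fin n → B × (U → Bool)) (i : Fin n) (x : B × (U → Bool)) :
    ((I.simulate T y i x.1).run x.2).1 ∈ I.H.C x.1 := by
  have := ProbeTree.probes_localize i (fun u => decide (0 ≤ I.H.w u x.1))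
    (edgeStates_update_of_ne y i x) (T (Function.update (fun j => (y j).1) i x.1))
  rw [edgeStates_update_self] at this
  have h := (hT (Function.update (fun j => (y j).1) i x.1)
    (edgeStates (Function.update y i x))).1 i
  simp only [StochGraph.ofTypes, Function.update_self] at h
  exact I.H.substring_mem _ _ h _ this.isInfix

omit [Fintype U] [DecidableEq U] [Fintype B] in
theorem eq_of_mem_offlineAccepted {x : Fin n → B × (U → Bool)} {e f : U × Fin n}
    (he : e ∈ offlineAccepted T x) (hf : f ∈ offlineAccepted T x)
    (h : e.1 = f.1 ∨ e.2 = f.2) : e = f := by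
  by_contra hne
  have : Std.Symm fun e f : U × Fin n => e.1 ≠ f.1 ∧ e.2 ≠ f.2 :=
    ⟨fun _ _ h => ⟨h.1.symm, h.2.symm⟩⟩
  have := (hT (fun i => (x i).1) (edgeStates x)).2.forall he hf hne
  tauto

omit [Fintype U] [Fintype B] in
theorem sum_offlinePartner_le_one (x : Fin n → B × (U → Bool)) (u : U) :
    ∑ i, (if I.offlinePartner T x i = some u then 1 else 0 : ℝ) ≤ 1 := by
  rw [← Finset.sum_filter, Finset.sum_const, nsmul_eq_mul, mul_one, Nat.cast_le_one,
    Finset.card_le_one]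
  intro i hi j hj
  simp only [Finset.mem_filter_univ] at hi hj
  exact congrArg Prod.snd (I.eq_of_mem_offlineAccepted hT (I.nonneg_of_offlinePartner T hi).1
    (I.nonneg_of_offlinePartner T hj).1 (Or.inl rfl))

omit [Fintype B] in
-- An accepted edge of nonnegative weight is recorded by its online endpoint, which has no other
-- accepted edge; dropping negative edges only increases the sum.
theorem weight_offlineAccepted_le (x : Fin n → B × (U → Bool)) :
    (I.H.ofTypes fun i => (x i).1).weight (offlineAccepted T x) ≤
      ∑ u, ∑ i, I.H.w u (x i).1 * if I.offlinePartner T x i = some u then 1 else 0 := by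
  have hnd : (offlineAccepted T x).Nodup :=
    (hT (fun i => (x i).1) (edgeStates x)).nodup_accepted
  have hterm : ∀ e : U × Fin n,
      0 ≤ I.H.w e.1 (x e.2).1 * if I.offlinePartner T x e.2 = some e.1 then 1 else 0 := by
    intro e
    split_ifs with h
    · simpa using (I.nonneg_of_offlinePartner T h).2
    · simp
  rw [← Fintype.sum_prod_type' (f := fun u i =>
    I.H.w u (x i).1 * if I.offlinePartner T x i = some u then 1 else 0), StochGraph.weight,
    ← List.sum_toFinset _ hnd]
  refine le_trans (Finset.sum_le_sum fun e he => ?_)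
    (Finset.sum_le_sum_of_subset_of_nonneg (Finset.subset_univ _) fun e _ _ => hterm e)
  rcases lt_or_ge (I.H.w e.1 (x e.2).1) 0 with hneg | hpos
  · exact hneg.le.trans (hterm e)
  · rw [if_pos, mul_one]
    · rfl
    · have he' : e ∈ offlineAccepted T x := List.mem_toFinset.1 he
      have hsome : ((offlineAccepted T x).find? fun f =>
          f.2 = e.2 && decide (0 ≤ I.H.w f.1 (x e.2).1)).isSome :=
        List.find?_isSome.2 ⟨e, he', by simp [hpos]⟩
      obtain ⟨f, hf⟩ := Option.isSome_iff_exists.1 hsome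
      have h2 := List.find?_some hf
      simp only [Bool.and_eq_true, decide_eq_true_eq] at h2
      have := I.eq_of_mem_offlineAccepted hT (List.mem_of_find?_eq_some hf) he' (Or.inr h2.1)
      simp [offlinePartner, hf, this]

end KnownIDInput

/-! ### Proposals to a vertex as the ground set of a contention resolution scheme -/

namespace KnownIDInput

variable {U : Type u} {B : Type v} [Fintype U] [DecidableEq U] [Fintype B] {n : ℕ}
  (I : KnownIDInput U B n) (T : (Fin n → B) → ProbeTree (U × Fin n) Unit)

/-- The joint law of the simulated data used by the online vertex `i`, and of its own type and
edge states. -/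
noncomputable def simProb (i : Fin n) (ω : (Fin n → B × (U → Bool)) × (B × (U → Bool))) : ℝ :=
  prodProb I.vertexProb ω.1 * I.vertexProb i ω.2

/-- The online vertex `i` proposes to `u`. -/
noncomputable def proposes (u : U) (i : Fin n) (ω : (Fin n → B × (U → Bool)) × (B × (U → Bool))) : Bool :=
  I.offlinePartner T (Function.update ω.1 i ω.2) i = some u

/-- The probability that the online vertex `i` proposes to `u`. -/
noncomputable def proposalProb (u : U) (i : Fin n) : ℝ :=
  ∑ ω, I.simProb i ω * if I.proposes T u i ω then 1 else 0

/-- The expected weight of a proposal of the online vertex `i` to `u`. -/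
noncomputable def proposalGain (u : U) (i : Fin n) : ℝ :=
  ∑ ω, I.simProb i ω * (I.H.w u ω.2.1 * if I.proposes T u i ω then 1 else 0)

omit [Fintype B] [DecidableEq U] in
theorem simProb_nonneg (i : Fin n) (ω : (Fin n → B × (U → Bool)) × (B × (U → Bool))) :
    0 ≤ I.simProb i ω :=
  mul_nonneg (prodProb_nonneg I.vertexProb_nonneg _) (I.vertexProb_nonneg _ _)

theorem sum_simProb (i : Fin n) : ∑ ω, I.simProb i ω = 1 := by
  have := sum_prodProb_update I.sum_vertexProb i fun _ => 1
  simp only [mul_one, sum_prodProb I.sum_vertexProb] at this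
  exact this

omit [Fintype U] [Fintype B] in
theorem weight_mul_proposes_nonneg (u : U) (i : Fin n)
    (ω : (Fin n → B × (U → Bool)) × (B × (U → Bool))) :
    0 ≤ I.H.w u ω.2.1 * if I.proposes T u i ω then 1 else 0 := by
  split_ifs with h
  · have := (I.nonneg_of_offlinePartner T (of_decide_eq_true h)).2
    simpa using this
  · simp

theorem proposalGain_nonneg (u : U) (i : Fin n) : 0 ≤ I.proposalGain T u i :=
  Finset.sum_nonneg fun ω _ =>
    mul_nonneg (I.simProb_nonneg i ω) (I.weight_mul_proposes_nonneg T u i ω)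

theorem proposalProb_nonneg (u : U) (i : Fin n) : 0 ≤ I.proposalProb T u i :=
  Finset.sum_nonneg fun ω _ => mul_nonneg (I.simProb_nonneg i ω) (by split_ifs <;> simp)

theorem simProb_eq_zero_of_proposalProb_eq_zero {u : U} {i : Fin n} (h : I.proposalProb T u i = 0)
    {ω : (Fin n → B × (U → Bool)) × (B × (U → Bool))} (hω : I.proposes T u i ω) :
    I.simProb i ω = 0 := by
  have := (Finset.sum_eq_zero_iff_of_nonneg fun ω _ =>
    mul_nonneg (I.simProb_nonneg i ω) (by split_ifs <;> simp)).1 h ω (Finset.mem_univ _)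
  simpa [hω] using this

theorem proposalGain_eq_zero_of_proposalProb_eq_zero {u : U} {i : Fin n}
    (h : I.proposalProb T u i = 0) : I.proposalGain T u i = 0 := by
  refine Finset.sum_eq_zero fun ω _ => ?_
  by_cases hω : I.proposes T u i ω
  · rw [I.simProb_eq_zero_of_proposalProb_eq_zero T h hω, zero_mul]
  · simp [hω]

/-- Resampling the coordinate `i` replaces sample and real data by one draw of the input, on which a
single offline run describes all the vertices `i` at once. -/
theorem proposalProb_eq (u : U) (i : Fin n) : I.proposalProb T u i =
    ∑ x, prodProb I.vertexProb x * if I.offlinePartner T x i = some u then 1 else 0 := by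
  rw [← sum_prodProb_update I.sum_vertexProb i]
  simp [proposalProb, proposes, simProb]

theorem proposalGain_eq (u : U) (i : Fin n) : I.proposalGain T u i =
    ∑ x, prodProb I.vertexProb x *
      (I.H.w u (x i).1 * if I.offlinePartner T x i = some u then 1 else 0) := by
  rw [← sum_prodProb_update I.sum_vertexProb i]
  simp [proposalGain, proposes, simProb]

variable {T}

theorem proposalProb_mem_uniformPolytope
    (hT : ∀ b st, (I.H.ofTypes b).Feasible ((T b).run st).1 ((T b).run st).2.1) (u : U) :
    I.proposalProb T u ∈ uniformPolytope n := by
  have hle : ∑ i, I.proposalProb T u i ≤ 1 := by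
    simp_rw [proposalProb_eq]
    rw [Finset.sum_comm]
    refine le_of_le_of_eq ?_ (sum_prodProb I.sum_vertexProb)
    refine Finset.sum_le_sum fun x _ => ?_
    rw [← Finset.mul_sum]
    exact mul_le_of_le_one_right (prodProb_nonneg I.vertexProb_nonneg x)
      (I.sum_offlinePartner_le_one hT x u)
  exact ⟨fun i => ⟨I.proposalProb_nonneg T u i, (Finset.single_le_sum
    (fun j _ => I.proposalProb_nonneg T u j) (Finset.mem_univ i)).trans hle⟩, hle⟩

theorem opt_le_sum_proposalGain
    (hT : ∀ b st, (I.H.ofTypes b).Feasible ((T b).run st).1 ((T b).run st).2.1)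
    (hopt : ∀ b, (I.H.ofTypes b).opt ≤ ∑ st : U × Fin n → Bool,
      (I.H.ofTypes b).stateProb st * (I.H.ofTypes b).weight ((T b).run st).2.1) :
    I.opt ≤ ∑ u, ∑ i, I.proposalGain T u i := by
  calc I.opt ≤ ∑ b, I.typeProb b * ∑ st : U × Fin n → Bool,
        (I.H.ofTypes b).stateProb st * (I.H.ofTypes b).weight ((T b).run st).2.1 :=
        Finset.sum_le_sum fun b _ => mul_le_mul_of_nonneg_left (hopt b)
          (Finset.prod_nonneg fun _ _ => ENNReal.toReal_nonneg)
    _ = ∑ x, prodProb I.vertexProb x *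
          (I.H.ofTypes fun i => (x i).1).weight (offlineAccepted T x) :=
        I.sum_typeProb_stateProb fun b st => (I.H.ofTypes b).weight ((T b).run st).2.1
    _ ≤ ∑ x, prodProb I.vertexProb x *
          ∑ u, ∑ i, I.H.w u (x i).1 * if I.offlinePartner T x i = some u then 1 else 0 :=
        Finset.sum_le_sum fun x _ => mul_le_mul_of_nonneg_left
          (I.weight_offlineAccepted_le hT x) (prodProb_nonneg I.vertexProb_nonneg x)
    _ = ∑ u, ∑ i, I.proposalGain T u i := by
        simp_rw [proposalGain_eq, Finset.mul_sum]
        rw [Finset.sum_comm]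
        exact Finset.sum_congr rfl fun u _ => Finset.sum_comm

end KnownIDInput

theorem SelectionRule.mem_of_run_eq_some {k : ℕ} (Z : Fin k → Bool) (t : ℕ) (R : SelectionRule k t)
    (arr : Fin t → Fin k) (i : Fin k) (h : SelectionRule.run Z t R arr = some i) : Z i = true := by
  induction t with
  | zero => simp [SelectionRule.run] at h
  | succ t ih =>
    rw [SelectionRule.run] at h
    split_ifs at h with hc
    · cases h
      simp_all
    · exact ih _ _ h

/-! ### The randomized online strategy -/

namespace KnownIDInput

variable {U : Type u} {B : Type v} [Fintype U] [DecidableEq U] [Fintype B] {n : ℕ}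
  (I : KnownIDInput U B n) {T : (Fin n → B) → ProbeTree (U × Fin n) Unit}

omit [Fintype U] [Fintype B] in
theorem feasible_ofRules_simulate
    (hT : ∀ b st, (I.H.ofTypes b).Feasible ((T b).run st).1 ((T b).run st).2.1)
    (s : Fin n → Fin n → B × (U → Bool)) (R : U → SelectionRule n n) (b : Fin n → B)
    (st : U × Fin n → Bool) (π : Equiv.Perm (Fin n)) :
    (I.H.ofTypes b).Feasible
      (OnlineStrategy.run b st n
        (OnlineStrategy.ofRules (fun i => I.simulate T (s i) i) n fun u => some (R u)) π).1
      (OnlineStrategy.run b st n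
        (OnlineStrategy.ofRules (fun i => I.simulate T (s i) i) n fun u => some (R u)) π).2 := by
  refine ⟨fun v => ?_, pairwise_accepted _ b st
    (fun i β σ => ProbeTree.accepted_localize _ _ _ _ _) n _ _ π.injective⟩
  rcases probes_ofRules (fun i => I.simulate T (s i) i) b st n (fun u => some (R u)) π
    π.injective v with h | h
  · rw [h]
    exact (I.H.ofTypes b).nil_mem v
  · rw [h]
    exact I.probes_simulate_mem hT (s v) v (b v, fun u => st (u, v))

variable (T)

/-- The expected weight of the accepted edges, given the seeds and the selection rules. -/
theorem value_ofRules_simulate (s : Fin n → Fin n → B × (U → Bool)) (R : U → SelectionRule n n)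
    (π : Equiv.Perm (Fin n)) :
    ∑ b : Fin n → B, I.typeProb b * ∑ st : U × Fin n → Bool, (I.H.ofTypes b).stateProb st *
      (I.H.ofTypes b).weight (OnlineStrategy.run b st n
        (OnlineStrategy.ofRules (fun i => I.simulate T (s i) i) n fun u => some (R u)) π).2 =
    ∑ x, ∑ u, ∑ i, prodProb I.vertexProb x * I.H.w u (x i).1 *
      if I.proposes T u i (s i, x i) ∧ SelectionRule.run
        (fun j => I.proposes T u j (s j, x j)) n (R u) π = some i then 1 else 0 := by
  rw [I.sum_typeProb_stateProb]
  refine Finset.sum_congr rfl fun x _ => ?_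
  rw [StochGraph.weight]
  have := sum_accepted_ofRules (fun i => I.simulate T (s i) i) (fun i => (x i).1) (edgeStates x)
    (fun i β σ => ProbeTree.accepted_localize _ _ _ _ _) (fun u i => I.H.w u (x i).1) n
    (fun u => some (R u)) π
  refine (congrArg _ this).trans ?_
  rw [Finset.mul_sum]
  refine Finset.sum_congr rfl fun u _ => ?_
  have hZ : (fun i => decide (proposal (fun i => I.simulate T (s i) i) (fun i => (x i).1)
      (edgeStates x) i = some u)) = fun j => I.proposes T u j (s j, x j) := by
    funext i
    have := I.result_simulate T (s i) i (x i)
    simp only [proposal, proposes, ← this]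
    rfl
  simp only [selected, Option.bind_some, hZ]
  cases hr : SelectionRule.run (fun j => I.proposes T u j (s j, x j)) n (R u) π with
  | none => simp
  | some i₀ =>
    have := SelectionRule.mem_of_run_eq_some _ _ _ _ _ hr
    rw [Finset.sum_eq_single i₀ (fun i _ h => by simp [Ne.symm h]) (by simp)]
    simp [this]

/-- The seeds and the selection rules are drawn in advance, independently of each other and of the
input. -/
theorem exists_strategy
    (hT : ∀ b st, (I.H.ofTypes b).Feasible ((T b).run st).1 ((T b).run st).2.1) (ψ : OnlineCRS) :
    ∃ A : RandomizedOnlineStrategy I, ∀ π, A.value π = ∑ u, ∑ i,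
      ψ.selectProb (I.proposalProb T u) π i / memProb (I.proposalProb T u) i *
        I.proposalGain T u i := by
  have : Nonempty (SelectionRule n n) := (ψ n 0).support_nonempty.to_type
  -- Any joint law of the rules would do: the value is a sum over `u`, so only the marginals enter.
  obtain ⟨μ, hμ⟩ := PMF.exists_coupling fun u => ψ n (I.proposalProb T u)
  -- One independent sample of the whole input for each online vertex; its own coordinate in it is
  -- never used.
  obtain ⟨ν, hν⟩ := PMF.exists_of_sum_eq_one
    (prodProb_nonneg fun (_ : Fin n) => prodProb_nonneg I.vertexProb_nonneg)
    (sum_prodProb fun _ => sum_prodProb I.sum_vertexProb)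
  let strat (s : Fin n → Fin n → B × (U → Bool)) (R : U → SelectionRule n n) :
      OnlineStrategy U B n n :=
    OnlineStrategy.ofRules (fun i => I.simulate T (s i) i) n fun u => some (R u)
  refine ⟨⟨ν.bind fun s => μ.map (strat s), ?_⟩, fun π => ?_⟩
  · intro A hA b st π
    obtain ⟨s, -, hs⟩ := (PMF.mem_support_bind_iff _ _ _).1 hA
    obtain ⟨R, -, rfl⟩ := (PMF.mem_support_map_iff _ _ _).1 hs
    exact I.feasible_ofRules_simulate hT s R b st π
  let ind (x : Fin n → B × (U → Bool)) (s : Fin n → Fin n → B × (U → Bool)) (u : U) (i : Fin n) (R : SelectionRule n n) : ℝ :=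
    if I.proposes T u i (s i, x i) ∧ SelectionRule.run
        (fun j => I.proposes T u j (s j, x j)) n R π = some i then 1 else 0
  let F (u : U) (i : Fin n) (Z : Fin n → Bool) : ℝ := expect (ψ n (I.proposalProb T u))
    fun R => if Z i = true ∧ SelectionRule.run Z n R π = some i then 1 else 0
  let val (A : OnlineStrategy U B n n) : ℝ := ∑ b : Fin n → B, I.typeProb b *
    ∑ st : U × Fin n → Bool, (I.H.ofTypes b).stateProb st *
      (I.H.ofTypes b).weight (OnlineStrategy.run b st n A π).2
  have hval : ∀ s R, val (strat s R) = ∑ x, ∑ u, ∑ i, prodProb I.vertexProb x *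
      I.H.w u (x i).1 * ind x s u i (R u) := fun s R => I.value_ofRules_simulate T s R π
  have hind : ∀ x s u i R, |ind x s u i R| ≤ 1 := by
    intro x s u i R
    simp only [ind]
    split_ifs <;> simp
  have hterm : ∀ x s u i R, |prodProb I.vertexProb x * I.H.w u (x i).1 * ind x s u i R| ≤
      |prodProb I.vertexProb x * I.H.w u (x i).1| := by
    intro x s u i R
    rw [abs_mul]
    exact mul_le_of_le_one_right (abs_nonneg _) (hind x s u i R)
  have hbound : ∀ s R, |val (strat s R)| ≤
      ∑ x, ∑ u, ∑ i, |prodProb I.vertexProb x * I.H.w u (x i).1| := by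
    intro s R
    rw [hval]
    refine (Finset.abs_sum_le_sum_abs _ _).trans (Finset.sum_le_sum fun x _ => ?_)
    refine (Finset.abs_sum_le_sum_abs _ _).trans (Finset.sum_le_sum fun u _ => ?_)
    exact (Finset.abs_sum_le_sum_abs _ _).trans (Finset.sum_le_sum fun i _ => hterm x s u i _)
  have hmarg : ∀ x s u i, expect μ (fun R => ind x s u i (R u)) =
      F u i fun j => I.proposes T u j (s j, x j) := by
    intro x s u i
    rw [← expect_map μ (fun R => R u) (f := ind x s u i) fun R => hind x s u i _, hμ]
  have hseed : ∀ s, expect (μ.map (strat s)) val = ∑ x, ∑ u, ∑ i,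
      prodProb I.vertexProb x * I.H.w u (x i).1 * F u i fun j => I.proposes T u j (s j, x j) := by
    intro s
    rw [expect_map μ (strat s) (hbound s)]
    simp_rw [hval]
    have h3 : ∀ x u (R : U → SelectionRule n n), |∑ i, prodProb I.vertexProb x *
        I.H.w u (x i).1 * ind x s u i (R u)| ≤ ∑ i, |prodProb I.vertexProb x * I.H.w u (x i).1| :=
      fun x u R => (Finset.abs_sum_le_sum_abs _ _).trans
        (Finset.sum_le_sum fun i _ => hterm x s u i _)
    have h4 : ∀ x (R : U → SelectionRule n n), |∑ u, ∑ i, prodProb I.vertexProb x *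
        I.H.w u (x i).1 * ind x s u i (R u)| ≤
          ∑ u, ∑ i, |prodProb I.vertexProb x * I.H.w u (x i).1| :=
      fun x R => (Finset.abs_sum_le_sum_abs _ _).trans (Finset.sum_le_sum fun u _ => h3 x u R)
    rw [expect_sum _ μ fun x _ => h4 x]
    refine Finset.sum_congr rfl fun x _ => ?_
    rw [expect_sum _ μ fun u _ => h3 x u]
    refine Finset.sum_congr rfl fun u _ => ?_
    rw [expect_sum _ μ fun i _ R => hterm x s u i (R u)]
    refine Finset.sum_congr rfl fun i _ => ?_
    rw [expect_const_mul, hmarg]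
  have hF : ∀ u i Z, Z i = false → F u i Z = 0 := by
    intro u i Z hZ
    simp [F, hZ, expect]
  change expect (ν.bind fun s => μ.map (strat s)) val = _
  rw [expect_bind_fintype]
  swap
  · intro s
    refine summable_toReal_mul (M := ∑ x, ∑ u, ∑ i, |prodProb I.vertexProb x * I.H.w u (x i).1|)
      _ fun A hA => ?_
    obtain ⟨R, -, rfl⟩ := (PMF.mem_support_map_iff _ _ _).1 hA
    exact hbound s R
  have hsum : ∑ s, (ν s).toReal * expect (μ.map (strat s)) val = ∑ u, ∑ i,
      ∑ ω : Fin n → (Fin n → B × (U → Bool)) × (B × (U → Bool)), prodProb I.simProb ω *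
        ((I.H.w u (ω i).2.1 * if I.proposes T u i (ω i) then 1 else 0) *
          F u i fun j => I.proposes T u j (ω j)) := by
    -- Pairing each seed with the real data of its vertex gives independent coordinates, which is
    -- the independence of the proposals.
    have h5 : ∀ s x, (ν s).toReal * prodProb I.vertexProb x =
        prodProb I.simProb fun i => (s i, x i) := by
      intro s x
      rw [hν]
      simp only [prodProb, simProb, Finset.prod_mul_distrib]
    simp_rw [hseed, Finset.mul_sum]
    rw [← Fintype.sum_prod_type' (f := fun s x => ∑ u, ∑ i, (ν s).toReal *
      (prodProb I.vertexProb x * I.H.w u (x i).1 * F u i fun j => I.proposes T u j (s j, x j))),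
      ← (Equiv.arrowProdEquivProdArrow _ _ _).sum_comp, Finset.sum_comm]
    refine Finset.sum_congr rfl fun u _ => ?_
    rw [Finset.sum_comm]
    refine Finset.sum_congr rfl fun i _ => Finset.sum_congr rfl fun ω _ => ?_
    rw [mul_assoc, ← mul_assoc _ (prodProb _ _), h5]
    refine congrArg₂ _ rfl ?_
    simp only [Equiv.arrowProdEquivProdArrow_apply]
    -- The indicator may be inserted because `F` vanishes when the bit of `i` is false.
    cases h : I.proposes T u i (ω i) with
    | true => simp
    | false => simp [hF, h]
  rw [hsum]
  refine Finset.sum_congr rfl fun u _ => Finset.sum_congr rfl fun i _ => ?_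
  have hkey := sum_prodProb_mul_bernProb I.sum_simProb (I.proposes T u) i
    (fun ω => I.H.w u ω.2.1 * if I.proposes T u i ω then 1 else 0)
    (fun ω h => by simp [h]) (F u i) (hF u i) (I.proposalProb T u) fun j => rfl
  rw [memProb_eq]
  -- Division by the proposal probability is impossible here, but both sides vanish.
  by_cases hz : I.proposalProb T u i = 0
  · rw [I.proposalGain_eq_zero_of_proposalProb_eq_zero T hz, mul_zero]
    refine Finset.sum_eq_zero fun ω _ => ?_
    by_cases hω : I.proposes T u i (ω i)
    · rw [prodProb, Finset.prod_eq_zero (Finset.mem_univ i)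
        (I.simProb_eq_zero_of_proposalProb_eq_zero T hz hω), zero_mul]
    · simp [hω]
  · rw [div_mul_eq_mul_div, eq_div_iff hz, mul_comm, hkey]
    rfl

/-- A randomized online strategy whose value is controlled by the selection probabilities of a
given contention resolution scheme. -/
theorem exists_strategy_value_eq (ψ : OnlineCRS) :
    ∃ (A : RandomizedOnlineStrategy I) (z : U → Fin n → ℝ) (gain : U → Fin n → ℝ),
      (∀ u, z u ∈ uniformPolytope n) ∧ (∀ u i, 0 ≤ gain u i) ∧
      (∀ u i, gain u i ≠ 0 → 0 < z u i) ∧ I.opt ≤ ∑ u, ∑ i, gain u i ∧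
      ∀ π, A.value π = ∑ u, ∑ i, ψ.selectProb (z u) π i / memProb (z u) i * gain u i := by
  choose T hT hopt using fun b : Fin n → B => (I.H.ofTypes b).exists_optimal_probeTree
  obtain ⟨A, hA⟩ := I.exists_strategy T hT ψ
  refine ⟨A, I.proposalProb T, I.proposalGain T, I.proposalProb_mem_uniformPolytope hT,
    I.proposalGain_nonneg T, fun u i h => ?_, I.opt_le_sum_proposalGain hT hopt, hA⟩
  exact (I.proposalProb_nonneg T u i).lt_of_ne fun h0 =>
    h (I.proposalGain_eq_zero_of_proposalProb_eq_zero T h0.symm)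

end KnownIDInput

/-! ### The two competitive guarantees -/

theorem mainTheorem4 (α : ℝ) (hα₀ : 0 ≤ α) (hα₁ : α ≤ 1) (ψ : OnlineCRS) :
    (ψ.SelectableAdversarial α →
      ∃ A : OnlineProbingAlg.{u, v}, A.CompetitiveAdversarial α) ∧
    (ψ.SelectableRandomOrder α →
      ∃ A : OnlineProbingAlg.{u, v}, A.CompetitiveRandomOrder α) := by
  let A : OnlineProbingAlg.{u, v} := fun U B _ _ _ n I =>
    Classical.choose (I.exists_strategy_value_eq ψ)
  refine ⟨fun h => ⟨A, ?_⟩, fun h => ⟨A, ?_⟩⟩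
  · intro U B _ _ _ n I π
    obtain ⟨z, gain, hz, hgain, hpos, hopt, hA⟩ := Classical.choose_spec
      (I.exists_strategy_value_eq ψ)
    refine (mul_le_mul_of_nonneg_left hopt hα₀).trans ?_
    rw [hA, Finset.mul_sum]
    refine Finset.sum_le_sum fun u _ => ?_
    rw [Finset.mul_sum]
    refine Finset.sum_le_sum fun i _ => ?_
    -- Selectability is only available for positive `z u i`, which a nonzero gain guarantees.
    by_cases hg : gain u i = 0
    · simp [hg]
    · exact mul_le_mul_of_nonneg_right (h n (z u) (hz u) π i (hpos u i hg)) (hgain u i)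
  · intro U B _ _ _ n I
    obtain ⟨z, gain, hz, hgain, hpos, hopt, hA⟩ := Classical.choose_spec
      (I.exists_strategy_value_eq ψ)
    refine (mul_le_mul_of_nonneg_left hopt hα₀).trans ?_
    -- The proposal probabilities and gains do not depend on the order, so the average over `π`
    -- falls on the selection probabilities alone.
    have hmean : (∑ π, (A U B n I).value π) / (n.factorial : ℝ) = ∑ u, ∑ i,
        (∑ π, ψ.selectProb (z u) π i) / (n.factorial : ℝ) / memProb (z u) i * gain u i := by
      simp_rw [A, hA]
      rw [Finset.sum_comm, Finset.sum_div]
      refine Finset.sum_congr rfl fun u _ => ?_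
      rw [Finset.sum_comm, Finset.sum_div]
      refine Finset.sum_congr rfl fun i _ => ?_
      rw [← Finset.sum_mul, ← Finset.sum_div]
      ring
    rw [hmean, Finset.mul_sum]
    refine Finset.sum_le_sum fun u _ => ?_
    rw [Finset.mul_sum]
    refine Finset.sum_le_sum fun i _ => ?_
    by_cases hg : gain u i = 0
    · simp [hg]
    · exact mul_le_mul_of_nonneg_right (h n (z u) (hz u) i (hpos u i hg)) (hgain u i)
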